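/- All graphs are finite and simple. For a graph $G$, let $\Delta(G)$ be its maximum degree, let $\mathrm{mad}(G)=\max_{H}\frac{2|E(H)|}{|V(H)|}$, the maximum being over all subgraphs $H$ of $G$ with at least one vertex, and let $G^2$ be the graph obtained from $G$ by adding edges to join the vertices at distance $2$ in $G$. The list chromatic number $\chi_\ell(G)$ is the least $k$ such that, whenever each vertex $v$ is given a list $L(v)$ of at least $k$ colors, $G$ has a proper coloring $\phi$ with $\phi(v)\in L(v)$ for all $v\in V(G)$. **Theorem.** If $\Delta(G)\le 6$ and $\mathrm{mad}(G)<\frac52$, then $\chi_\ell(G^2)\le 7$. Moreover, if $\Delta(G)=6$ (and $\mathrm{mad}(G)<\frac52$), then $\chi_\ell(G^2)=7$. -/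

import Mathlib

universe u w

namespace SimpleGraph

/-- The square `G²` of a graph: the edges of `G`, together with edges joining the vertices at
distance exactly `2` in `G`. (Vertices in different components have `G.dist` equal to `0`.) -/
def square {V : Type u} (G : SimpleGraph V) : SimpleGraph V where
  Adj x y := G.Adj x y ∨ G.dist x y = 2
  symm := ⟨fun x y h => h.imp (fun h => h.symm) (fun h => by rw [dist_comm]; exact h)⟩
  loopless := ⟨fun x h => by simp at h⟩

/-- The maximum average degree of a finite graph: the maximum of `2|E(H)|/|V(H)|` over the
subgraphs `H` with at least one vertex. (A finite graph has finitely many subgraphs, so that the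
supremum is a maximum whenever the graph has a vertex.) -/
noncomputable def mad {V : Type u} [Finite V] (G : SimpleGraph V) : ℝ :=
  ⨆ H : {H : G.Subgraph // H.verts.Nonempty},
    2 * (H.1.edgeSet.ncard : ℝ) / (H.1.verts.ncard : ℝ)

/-- `φ` is an `L`-coloring of `G`: a proper coloring choosing each color from the list of
its vertex. -/
def IsListColoring {V : Type u} (G : SimpleGraph V) {C : Type w} (L : V → Finset C)
    (φ : V → C) : Prop :=
  (∀ x y, G.Adj x y → φ x ≠ φ y) ∧ ∀ x, φ x ∈ L x

/-- `G` is `k`-choosable: it is `L`-colorable whenever each list has size at least `k`, for every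
set `C` of colors. -/
def IsChoosable {V : Type u} (G : SimpleGraph V) (k : ℕ) : Prop :=
  ∀ (C : Type w) (L : V → Finset C), (∀ x, k ≤ (L x).card) → ∃ φ : V → C, G.IsListColoring L φ

/-- The list chromatic number: the least `k` such that `G` is `k`-choosable (`⊤` if there is
none). -/
noncomputable def listChromaticNumber {V : Type u} (G : SimpleGraph V) : ℕ∞ :=
  ⨅ k ∈ {k : ℕ | IsChoosable.{u, w} G k}, (k : ℕ∞)

end SimpleGraph

/-! For the upper bound, fix lists of size 7 and take a minimal subgraph, on the same vertices,
whose square is not colorable from them. If a set containing an edge is uncolored, the rest has a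
proper coloring (`off_of_adj`), and a vertex with at most 6 colored neighbors in the square can be
colored greedily (`ColorableOff.of_insert`). Since `nbrSum` bounds the degree in the square, the
vertices of an edge, or of a path on four vertices, cannot all have small `nbrSum`
(`lt_nbrSum_of_adj`, `path_irreducible`).

Discharging from 4 deg - 10 on non-isolated vertices then shows that these have average degree at
least 5/2, against the bound on `mad`. Local rules suffice except at `middles`, which draw 2 each
from a pot into which every 6-vertex pays 2. That the pot suffices is the one global argument
(`card_middles_le`). A middle vertex with its two neighbors is an edge of a multigraph on the
6-vertices. If edges outnumbered vertices, there would be a 2-regular piece (`exists_alternating`)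
whose half-edges can be recolored: this is list coloring even cycles from lists of size two
(`exists_choice_ne_map`).

For the lower bound, a closed neighborhood is a clique in the square. -/

namespace SimpleGraph
-- Coloring squares greedily; reducible edges and paths.
section
open Classical in
theorem square_adj_iff {V : Type u} (G : SimpleGraph V) {x y : V} :
    G.square.Adj x y ↔ x ≠ y ∧ (G.Adj x y ∨ ∃ z, G.Adj x z ∧ G.Adj z y) := by
  constructor
  · intro h
    refine ⟨h.ne, ?_⟩
    rcases h with h | h
    · exact Or.inl h
    · right
      have hr : G.Reachable x y := Reachable.of_dist_ne_zero (by omega)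
      obtain ⟨p, hp⟩ := hr.exists_walk_length_eq_dist
      rw [h] at hp
      match p, hp with
      | .cons h1 (.cons h2 .nil), _ => exact ⟨_, h1, h2⟩
  · rintro ⟨hne, h | ⟨z, h1, h2⟩⟩
    · exact Or.inl h
    · by_cases h : G.Adj x y
      · exact Or.inl h
      · right
        have hle := dist_le (Walk.cons h1 (Walk.cons h2 Walk.nil))
        have hr : G.Reachable x y := ⟨Walk.cons h1 (Walk.cons h2 Walk.nil)⟩
        have h0 : G.dist x y ≠ 0 := fun h0 => hne (hr.dist_eq_zero_iff.1 h0)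
        have h1 : G.dist x y ≠ 1 := fun h1 => h (dist_eq_one_iff_adj.1 h1)
        simp at hle
        omega

open Classical in
theorem card_sdiff_add_two_le {V : Type u} {A S : Finset V} {a b : V} (ha : a ∈ A) (hb : b ∈ A)
    (hab : a ≠ b) (haS : a ∈ S) (hbS : b ∈ S) : (A \ S).card + 2 ≤ A.card := by
  have h : (A \ S) ∪ {a, b} ⊆ A := by
    intro x
    simp only [Finset.mem_union, Finset.mem_sdiff, Finset.mem_insert, Finset.mem_singleton]
    rintro (h | rfl | rfl)
    exacts [h.1, ha, hb]
  have hd : Disjoint (A \ S) {a, b} := by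
    rw [Finset.disjoint_left]
    intro x hx
    simp only [Finset.mem_insert, Finset.mem_singleton]
    rintro (rfl | rfl)
    exacts [(Finset.mem_sdiff.1 hx).2 haS, (Finset.mem_sdiff.1 hx).2 hbS]
  have := Finset.card_le_card h
  rwa [Finset.card_union_of_disjoint hd, Finset.card_pair hab] at this

open Classical in
theorem card_sdiff_add_one_le {V : Type u} {A S : Finset V} {a : V} (ha : a ∈ A) (haS : a ∈ S) :
    (A \ S).card + 1 ≤ A.card :=
  Finset.card_lt_card ⟨Finset.sdiff_subset, fun h => (Finset.mem_sdiff.1 (h ha)).2 haS⟩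

/-- Some choice from the lists is a proper coloring of `G²` away from `S`. -/
def ColorableOff {V : Type u} (G : SimpleGraph V) {C : Type w} (L : V → Finset C)
    (S : Finset V) : Prop :=
  ∃ φ : V → C, (∀ x, φ x ∈ L x) ∧ ∀ x y, x ∉ S → y ∉ S → G.square.Adj x y → φ x ≠ φ y

theorem colorableOff_empty_iff {V : Type u} {G : SimpleGraph V} {C : Type w}
    {L : V → Finset C} : G.ColorableOff L ∅ ↔ ∃ φ : V → C, G.square.IsListColoring L φ := by
  simp only [ColorableOff, IsListColoring, Finset.notMem_empty, not_false_eq_true,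
    forall_const, and_comm]

variable {V : Type u} [Fintype V] {G : SimpleGraph V} {C : Type w} {L : V → Finset C}

open Classical in
/-- The neighbors of `v` in `G²`. -/
noncomputable def sqNbr (G : SimpleGraph V) (v : V) : Finset V :=
  Finset.univ.filter (G.square.Adj v)

theorem mem_sqNbr {v w : V} : w ∈ G.sqNbr v ↔ G.square.Adj v w := by simp [sqNbr]

open Classical in
/-- The sum of the degrees of the neighbors of `v`. -/
noncomputable def nbrSum (G : SimpleGraph V) (v : V) : ℕ :=
  ∑ u ∈ G.neighborFinset v, G.degree u

-- Each neighbor `u` of `v` accounts for itself and for its neighbors other than `v`, hence for `deg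
-- u` vertices.
open Classical in
theorem card_sqNbr_le (v : V) : (G.sqNbr v).card ≤ G.nbrSum v := by
  have h : G.sqNbr v ⊆ (G.neighborFinset v).biUnion
      fun u => insert u ((G.neighborFinset u).erase v) := by
    intro w hw
    rw [mem_sqNbr, square_adj_iff] at hw
    obtain ⟨hne, h | ⟨z, h1, h2⟩⟩ := hw
    · exact Finset.mem_biUnion.2 ⟨w, by simpa using h, by simp⟩
    · exact Finset.mem_biUnion.2 ⟨z, by simpa using h1, by simp [h2, hne.symm]⟩
  refine (Finset.card_le_card h).trans (Finset.card_biUnion_le.trans (Finset.sum_le_sum ?_))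
  intro u hu
  rw [mem_neighborFinset] at hu
  refine (Finset.card_insert_le _ _).trans ?_
  rw [Finset.card_erase_of_mem (by simpa using hu.symm), card_neighborFinset_eq_degree]
  have : 0 < G.degree u := (G.degree_pos_iff_exists_adj u).2 ⟨v, hu.symm⟩
  omega

open Classical in
theorem ColorableOff.of_insert {v : V} {S : Finset V} (h : G.ColorableOff L (insert v S))
    (hc : (G.sqNbr v \ S).card < (L v).card) : G.ColorableOff L S := by
  obtain ⟨φ, hL, hφ⟩ := h
  obtain ⟨c, hcL, hcn⟩ := Finset.exists_mem_notMem_of_card_lt_card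
    ((Finset.card_image_le (s := G.sqNbr v \ S) (f := φ)).trans_lt hc)
  have hcn' : ∀ y, y ∉ S → G.square.Adj v y → c ≠ φ y := fun y hy hv he =>
    hcn (Finset.mem_image.2 ⟨y, by simp [mem_sqNbr, hv, hy], he.symm⟩)
  refine ⟨Function.update φ v c, fun x => ?_, fun x y hx hy hxy => ?_⟩
  · by_cases hx : x = v
    · subst hx; simpa using hcL
    · simpa [hx] using hL x
  · by_cases hxv : x = v
    · subst hxv
      rw [Function.update_self, Function.update_of_ne hxy.ne']
      exact hcn' y hy hxy
    · by_cases hyv : y = v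
      · subst hyv
        rw [Function.update_self, Function.update_of_ne hxv]
        exact (hcn' x hx hxy.symm).symm
      · rw [Function.update_of_ne hxv, Function.update_of_ne hyv]
        exact hφ x y (by simp [hxv, hx]) (by simp [hyv, hy]) hxy

/-- `G` is a minimal graph whose square is not colorable from `L`; of minimality only the two
consequences that are used are kept. -/
structure IsCritical (G : SimpleGraph V) (L : V → Finset C) : Prop where
  card_le : ∀ x, 7 ≤ (L x).card
  off_of_adj : ∀ S : Finset V, ∀ a ∈ S, ∀ b ∈ S, G.Adj a b → G.ColorableOff L S
  degree_ne_one : ∀ v u : V, ¬ ∀ x, G.Adj v x ↔ x = u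
  not_colorable : ¬ G.ColorableOff L ∅

-- Deleting the edges inside `S` breaks no path of length two with both ends outside `S`. Isolating
-- a leaf breaks no such path between other vertices, and the leaf has at most 6 neighbors in the
-- square, so it can be colored last.
open Classical in
theorem IsCritical.of_minimal (hL : ∀ x, 7 ≤ (L x).card) (hG : ¬ G.ColorableOff L ∅)
    (hmin : ∀ H < G, H.ColorableOff L ∅)
    (hΔ : ∀ v, G.degree v ≤ 6) : G.IsCritical L := by
  refine ⟨hL, ?_, ?_, hG⟩
  · intro S a ha b hb hab
    let H : SimpleGraph V :=
      { Adj := fun x y => G.Adj x y ∧ ¬ (x ∈ S ∧ y ∈ S)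
        symm := ⟨fun x y h => ⟨h.1.symm, fun h' => h.2 h'.symm⟩⟩
        loopless := ⟨fun x h => G.loopless.irrefl x h.1⟩ }
    have hH : H < G := by
      refine lt_of_le_of_ne (fun x y h => h.1) fun h => ?_
      have : H.Adj a b := h ▸ hab
      exact this.2 ⟨ha, hb⟩
    obtain ⟨φ, h1, h2⟩ := hmin H hH
    refine ⟨φ, h1, fun x y hx hy hxy => h2 x y (by simp) (by simp) ?_⟩
    rw [square_adj_iff] at hxy ⊢
    obtain ⟨hne, h | ⟨z, h3, h4⟩⟩ := hxy
    · exact ⟨hne, Or.inl ⟨h, fun h => hx h.1⟩⟩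
    · exact ⟨hne, Or.inr ⟨z, ⟨h3, fun h => hx h.1⟩, ⟨h4, fun h => hy h.2⟩⟩⟩
  · intro v u hvu
    have huv : G.Adj v u := (hvu u).2 rfl
    let H : SimpleGraph V :=
      { Adj := fun x y => G.Adj x y ∧ x ≠ v ∧ y ≠ v
        symm := ⟨fun x y h => ⟨h.1.symm, h.2.symm⟩⟩
        loopless := ⟨fun x h => G.loopless.irrefl x h.1⟩ }
    have hH : H < G := by
      refine lt_of_le_of_ne (fun x y h => h.1) fun h => ?_
      have : H.Adj v u := h ▸ huv
      exact this.2.1 rfl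
    obtain ⟨φ, h1, h2⟩ := hmin H hH
    have hv : G.ColorableOff L (insert v ∅) := by
      refine ⟨φ, h1, fun x y hx hy hxy => h2 x y (by simp) (by simp) ?_⟩
      have hxv : x ≠ v := by simpa using hx
      have hyv : y ≠ v := by simpa using hy
      rw [square_adj_iff] at hxy ⊢
      obtain ⟨hne, h | ⟨z, h3, h4⟩⟩ := hxy
      · exact ⟨hne, Or.inl ⟨h, hxv, hyv⟩⟩
      · have hz : z ≠ v := by
          rintro rfl
          exact hne (((hvu x).1 h3.symm).trans ((hvu y).1 h4).symm)
        exact ⟨hne, Or.inr ⟨z, ⟨h3, hxv, hz⟩, ⟨h4, hz, hyv⟩⟩⟩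
    refine hG (hv.of_insert ?_)
    have h3 : G.neighborFinset v = {u} := by ext x; simp [hvu]
    have h4 := card_sqNbr_le (G := G) v
    rw [nbrSum, h3, Finset.sum_singleton] at h4
    have := hΔ u
    have := hL v
    simp only [Finset.sdiff_empty]
    omega

open Classical in
/-- Of two adjacent vertices, recolored one after the other, one has many neighbors in `G²`. -/
theorem IsCritical.lt_nbrSum_of_adj (h : G.IsCritical L) {a b : V} (hab : G.Adj a b)
    (ha : G.nbrSum a ≤ 7) : 6 < G.nbrSum b := by
  by_contra! hb
  have h0 := h.off_of_adj (insert a (insert b ∅)) a (by simp) b (by simp) hab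
  refine h.not_colorable ((h0.of_insert ?_).of_insert ?_)
  · have h1 := card_sdiff_add_one_le (S := insert b ∅) (mem_sqNbr.2 (Or.inl hab)) (by simp)
    have := card_sqNbr_le (G := G) a
    have := h.card_le a
    omega
  · have := card_sqNbr_le (G := G) b
    have := h.card_le b
    simp only [Finset.sdiff_empty]
    omega

open Classical in
/-- The path `x y t z` cannot be recolored in the order `x, t, z, y`. -/
theorem IsCritical.path_irreducible (h : G.IsCritical L) {x y t z : V} (hxy : G.Adj x y)
    (hyt : G.Adj y t) (htz : G.Adj t z) (hxt : x ≠ t) (hyz : y ≠ z)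
    (hx : G.nbrSum x ≤ 8) (ht : G.nbrSum t ≤ 8) (hz : G.nbrSum z ≤ 7) : 6 < G.nbrSum y := by
  by_contra! hy
  have h0 := h.off_of_adj (insert x (insert t (insert z (insert y ∅))))
    x (by simp) y (by simp) hxy
  have hyz2 : G.square.Adj y z := (square_adj_iff G).2 ⟨hyz, Or.inr ⟨t, hyt, htz⟩⟩
  have hxt2 : G.square.Adj x t := (square_adj_iff G).2 ⟨hxt, Or.inr ⟨y, hxy, hyt⟩⟩
  -- When their turn comes, `x` and `t` still have two uncolored neighbors in the square, `z` has
  -- one and `y` none: hence the bounds 8, 8, 7, 6.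
  refine h.not_colorable ((((h0.of_insert ?_).of_insert ?_).of_insert ?_).of_insert ?_)
  · have h1 := card_sdiff_add_two_le (S := insert t (insert z (insert y ∅)))
      (mem_sqNbr.2 (Or.inl hxy)) (mem_sqNbr.2 hxt2) hyt.ne (by simp) (by simp)
    have := card_sqNbr_le (G := G) x
    have := h.card_le x
    omega
  · have h1 := card_sdiff_add_two_le (S := insert z (insert y ∅))
      (mem_sqNbr.2 (Or.inl hyt.symm)) (mem_sqNbr.2 (Or.inl htz)) hyz (by simp) (by simp)
    have := card_sqNbr_le (G := G) t
    have := h.card_le t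
    omega
  · have h1 := card_sdiff_add_one_le (S := insert y ∅) (mem_sqNbr.2 hyz2.symm) (by simp)
    have := card_sqNbr_le (G := G) z
    have := h.card_le z
    omega
  · have := card_sqNbr_le (G := G) y
    have := h.card_le y
    simp only [Finset.sdiff_empty]
    omega

end

/-! ### Two combinatorial tools: list coloring along a map, and 2-regular pieces of a multigraph. -/

section

open Classical in
/-- List coloring of the orbits of a map `g` that switches sides: a list of two colors suffices
where the image under `g` is to be colored as well. -/
theorem exists_choice_ne_map {V : Type u} {C : Type w} (g : V → V) (T : Set V) (φ₀ : V → C) :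
    ∀ (Y : Finset V) (L : V → Finset C), (∀ x ∈ Y, (g x ∈ T ↔ x ∉ T)) →
      (∀ x ∈ Y, 1 ≤ (L x).card) → (∀ x ∈ Y, g x ∈ Y → 2 ≤ (L x).card) →
      ∃ φ : V → C, ∀ x ∈ Y, φ x ∈ L x ∧ (g x ∈ Y → φ x ≠ φ (g x)) := by
  intro Y
  induction Y using Finset.strongInduction with
  | H Y ih =>
    intro L hT h1 h2
    -- If, perhaps after shrinking lists, some `x` has a color that `g x` cannot use, give it to `x`
    -- and delete it from the lists of the preimages of `x`. These lose their constraint towards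
    -- `x`, so one remaining color is enough for them.
    by_cases hex : ∃ L' : V → Finset C, (∀ x, L' x ⊆ L x) ∧ (∀ x ∈ Y, 1 ≤ (L' x).card) ∧
        (∀ x ∈ Y, g x ∈ Y → 2 ≤ (L' x).card) ∧
        ∃ x ∈ Y, ∃ c ∈ L' x, g x ∈ Y → c ∉ L' (g x)
    · obtain ⟨L', hL', h1', h2', x, hx, c, hc, hcg⟩ := hex
      have hgx : g x ≠ x := fun h => by have := hT x hx; rw [h] at this; tauto
      obtain ⟨φ, hφ⟩ := ih (Y.erase x) (Finset.erase_ssubset hx)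
        (fun y => if g y = x then (L' y).erase c else L' y)
        (fun y hy => hT y (Finset.mem_of_mem_erase hy))
        (fun y hy => by
          have hy' := Finset.mem_of_mem_erase hy
          split_ifs with h
          · have := h2' y hy' (h ▸ hx)
            have := Finset.pred_card_le_card_erase (s := L' y) (a := c)
            omega
          · exact h1' y hy')
        (fun y hy hgy => by
          rw [if_neg (Finset.ne_of_mem_erase hgy)]
          exact h2' y (Finset.mem_of_mem_erase hy) (Finset.mem_of_mem_erase hgy))
      refine ⟨Function.update φ x c, fun y hy => ?_⟩
      by_cases hyx : y = x
      · subst hyx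
        rw [Function.update_self, Function.update_of_ne hgx]
        refine ⟨hL' _ hc, fun hgy he => ?_⟩
        have h3 := (hφ (g y) (by simp [hgy, hgx])).1
        refine hcg hgy (he ▸ ?_)
        split_ifs at h3
        · exact Finset.mem_of_mem_erase h3
        · exact h3
      · have h3 := hφ y (by simp [hyx, hy])
        rw [Function.update_of_ne hyx]
        refine ⟨hL' _ ?_, fun hgy => ?_⟩
        · have h4 := h3.1
          split_ifs at h4
          · exact Finset.mem_of_mem_erase h4
          · exact h4
        · by_cases hgyx : g y = x
          · rw [hgyx, Function.update_self]
            have h4 := h3.1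
            rw [if_pos hgyx] at h4
            exact Finset.ne_of_mem_erase h4
          · rw [Function.update_of_ne hgyx]
            exact h3.2 (by simp [hgyx, hgy])
    -- Otherwise `g` preserves `Y`, and lists trimmed to two colors are constant along `g`. The side
    -- of `T` decides which of the two colors to use.
    · push Not at hex
      have hgY : ∀ x ∈ Y, g x ∈ Y := by
        intro x hx
        obtain ⟨c, hc⟩ := Finset.card_pos.1 (h1 x hx)
        exact (hex L (fun _ => subset_rfl) h1 h2 x hx c hc).1
      have htrim : ∀ x, ∃ A ⊆ L x, x ∈ Y → A.card = 2 := by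
        intro x
        by_cases hx : x ∈ Y
        · obtain ⟨A, hA, hA2⟩ := Finset.exists_subset_card_eq (h2 x hx (hgY x hx))
          exact ⟨A, hA, fun _ => hA2⟩
        · exact ⟨L x, subset_rfl, fun h => absurd h hx⟩
      choose A hAL hA using htrim
      have hA1 : ∀ x ∈ Y, A x = A (g x) := fun x hx =>
        Finset.eq_of_subset_of_card_le
          (fun c hc => (hex A hAL (fun x hx => by rw [hA x hx]; norm_num)
            (fun x hx _ => (hA x hx).ge) x hx c hc).2)
          (by rw [hA x hx, hA _ (hgY x hx)])
      obtain hV | ⟨⟨v⟩⟩ := isEmpty_or_nonempty V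
      · exact ⟨φ₀, fun x => hV.elim x⟩
      have hpair : ∀ B : Finset C, ∃ p : C × C, B.card = 2 → p.1 ∈ B ∧ p.2 ∈ B ∧ p.1 ≠ p.2 := by
        intro B
        by_cases hB : B.card = 2
        · obtain ⟨a, b, hab, rfl⟩ := Finset.card_eq_two.1 hB
          exact ⟨(a, b), fun _ => by simp [hab]⟩
        · exact ⟨(φ₀ v, φ₀ v), fun h => absurd h hB⟩
      choose p hp using hpair
      refine ⟨fun x => if x ∈ T then (p (A x)).1 else (p (A x)).2, fun x hx => ?_⟩
      have h3 := hp (A x) (hA x hx)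
      have h4 := hT x hx
      dsimp only
      rw [← hA1 x hx]
      refine ⟨hAL x ?_, fun _ => ?_⟩
      · split_ifs
        exacts [h3.1, h3.2.1]
      · by_cases hxT : x ∈ T
        · rw [if_pos hxT, if_neg (by tauto)]
          exact h3.2.2
        · rw [if_neg hxT, if_pos (by tauto)]
          exact h3.2.2.symm

open Classical in
/-- If the edges of a multigraph, given as disjoint pairs `N m` of half-edges `x` at vertices
`u x`, outnumber its vertices, then some of them form a 2-regular multigraph whose half-edges are
consistently oriented and alternate between two sides. -/
theorem exists_alternating {V : Type u} (N : V → Finset V) (u : V → V) (M : Finset V)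
    (hN : ∀ m ∈ M, (N m).card = 2)
    (hdis : ∀ m ∈ M, ∀ m' ∈ M, ∀ x, x ∈ N m → x ∈ N m' → m = m')
    (hne : M.Nonempty) (hM : ((M.biUnion N).image u).card ≤ M.card) :
    ∃ M' ⊆ M, M'.Nonempty ∧ ∃ (g : V → V) (T : Set V),
      (∀ x ∈ M'.biUnion N, ((M'.biUnion N).filter (fun y => u y = u x)).card = 2) ∧
      (∀ x ∈ M'.biUnion N, (g x ∈ T ↔ x ∉ T)) ∧
      (∀ x ∈ M'.biUnion N, ∀ y ∈ M'.biUnion N, x ≠ y → u x = u y → g x = y ∨ g y = x) ∧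
      (∀ m ∈ M', ∀ x ∈ N m, ∀ y ∈ N m, x ≠ y → g x = y ∨ g y = x) := by
  -- By minimality, every nonempty proper subset of `M'` has fewer edges than vertices. So `M'` has
  -- equally many of both, and no vertex meets a single half-edge, since that vertex and its edge
  -- could be deleted.
  obtain ⟨M', hmin⟩ := exists_minimal_of_wellFoundedLT
    (fun A : Finset V => A ⊆ M ∧ A.Nonempty ∧ ((A.biUnion N).image u).card ≤ A.card)
    ⟨M, subset_rfl, hne, hM⟩
  obtain ⟨hsub, hne', hcard⟩ := hmin.prop
  have hlt : ∀ A : Finset V, A ⊂ M' → A.Nonempty → A.card < ((A.biUnion N).image u).card := by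
    intro A hA hAne
    by_contra! hle
    exact hA.2 (hmin.le_of_le ⟨hA.1.trans hsub, hAne, hle⟩ hA.1)
  refine ⟨M', hsub, hne', ?_⟩
  set X := M'.biUnion N with hX
  have hXcard : X.card = 2 * M'.card := by
    rw [hX, Finset.card_biUnion, Finset.sum_congr rfl (fun m hm => hN m (hsub hm)),
      Finset.sum_const, smul_eq_mul, mul_comm]
    intro m hm m' hm' hmm
    rw [Function.onFun, Finset.disjoint_left]
    exact fun x hx hx' => hmm (hdis m (hsub hm) m' (hsub hm') x hx hx')
  obtain ⟨m₀, hm₀⟩ := hne'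
  have himpos : 0 < (X.image u).card := by
    obtain ⟨x, hx⟩ := Finset.card_pos.1 (by rw [hN m₀ (hsub hm₀)]; norm_num : 0 < (N m₀).card)
    exact Finset.card_pos.2 ⟨u x, Finset.mem_image_of_mem u (Finset.mem_biUnion.2 ⟨m₀, hm₀, hx⟩)⟩
  have heq : (X.image u).card = M'.card := by
    refine le_antisymm hcard ?_
    by_contra! hlt'
    have hss := Finset.erase_ssubset hm₀
    have hc := Finset.card_erase_of_mem hm₀
    have h1 := hlt (M'.erase m₀) hss (Finset.card_pos.1 (by omega))
    have h2 : (((M'.erase m₀).biUnion N).image u).card ≤ (X.image u).card :=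
      Finset.card_le_card (Finset.image_subset_image (Finset.biUnion_subset_biUnion_of_subset_left _ hss.1))
    omega
  have hfib2 : ∀ b ∈ X.image u, 2 ≤ (X.filter (fun y => u y = b)).card := by
    intro b hb
    by_contra! hlt2
    obtain ⟨x, hx, rfl⟩ := Finset.mem_image.1 hb
    have hone : ∀ y ∈ X, u y = u x → y = x := fun y hy hyx =>
      Finset.card_le_one.1 (by omega : (X.filter (fun y => u y = u x)).card ≤ 1) y
        (by simp [hy, hyx]) x (by simp [hx])
    obtain ⟨m, hm, hxm⟩ := Finset.mem_biUnion.1 hx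
    have hss := Finset.erase_ssubset hm
    have hc := Finset.card_erase_of_mem hm
    have himsub : ((M'.erase m).biUnion N).image u ⊆ (X.image u).erase (u x) := by
      intro b hb'
      obtain ⟨y, hy, rfl⟩ := Finset.mem_image.1 hb'
      obtain ⟨m', hm', hym'⟩ := Finset.mem_biUnion.1 hy
      have hm'' := Finset.mem_of_mem_erase hm'
      have hyX : y ∈ X := Finset.mem_biUnion.2 ⟨m', hm'', hym'⟩
      refine Finset.mem_erase.2 ⟨fun he => ?_, Finset.mem_image_of_mem u hyX⟩
      have := hone y hyX he
      subst this
      exact Finset.ne_of_mem_erase hm' (hdis m' (hsub hm'') m (hsub hm) y hym' hxm)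
    have h1 := Finset.card_le_card himsub
    rw [Finset.card_erase_of_mem hb] at h1
    rcases (M'.erase m).eq_empty_or_nonempty with h0 | h0
    · have hM1 : M'.card = 1 := by
        have := Finset.card_pos.2 ⟨m, hm⟩
        rw [h0, Finset.card_empty] at hc
        omega
      have : X.card ≤ 1 := Finset.card_le_one.2 (fun y hy z hz => by
        have hc1 := Finset.card_le_one.1 (by omega : (X.image u).card ≤ 1)
        rw [hone y hy (hc1 _ (Finset.mem_image_of_mem u hy) _ hb),
          hone z hz (hc1 _ (Finset.mem_image_of_mem u hz) _ hb)])
      omega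
    · have := hlt _ hss h0
      omega
  have hfib : ∀ b ∈ X.image u, (X.filter (fun y => u y = b)).card = 2 := by
    have hs := Finset.card_eq_sum_card_fiberwise (f := u) (s := X) (t := X.image u)
      (fun x hx => by simpa using ⟨x, hx, rfl⟩)
    have hs2 : ∑ b ∈ X.image u, 2 = ∑ b ∈ X.image u, (X.filter (fun y => u y = b)).card := by
      rw [← hs, hXcard, Finset.sum_const, heq, smul_eq_mul, mul_comm]
    intro b hb
    exact ((Finset.sum_eq_sum_iff_of_le hfib2).1 hs2 b hb).symm
  -- Hall's condition holds by minimality. The matching of edges to their ends selects one half-edge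
  -- of each edge and, as the numbers agree, one at each vertex; these form `T`.
  obtain ⟨h, hinj, hmem⟩ := (Finset.all_card_le_biUnion_card_iff_exists_injective
    (fun m : M' => (N m).image u)).1 (by
      intro A
      have himg : A.biUnion (fun m : M' => (N m).image u) =
          ((A.image Subtype.val).biUnion N).image u := by
        ext b
        simp only [Finset.mem_biUnion, Finset.mem_image]
        constructor
        · rintro ⟨m, hm, x, hx, rfl⟩
          exact ⟨x, ⟨m, ⟨m, hm, rfl⟩, hx⟩, rfl⟩
        · rintro ⟨x, ⟨_, ⟨m, hm, rfl⟩, hx⟩, rfl⟩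
          exact ⟨m, hm, x, hx, rfl⟩
      rw [himg, ← Finset.card_image_of_injective A Subtype.val_injective]
      have hsubA : A.image Subtype.val ⊆ M' := by
        intro m hm
        obtain ⟨m', _, rfl⟩ := Finset.mem_image.1 hm
        exact m'.2
      rcases (A.image Subtype.val).eq_empty_or_nonempty with h0 | h0
      · rw [h0]; simp
      · rcases hsubA.eq_or_ssubset with h1 | h1
        · rw [h1]; exact heq.ge
        · exact (hlt _ h1 h0).le)
  have hk : ∀ m : M', ∃ x ∈ N m, u x = h m := fun m => Finset.mem_image.1 (hmem m)
  choose k hkN hku using hk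
  have hkX : ∀ m, k m ∈ X := fun m => Finset.mem_biUnion.2 ⟨m, m.2, hkN m⟩
  have huk : ∀ m m', u (k m) = u (k m') → m = m' := fun m m' he =>
    hinj (by rw [← hku, ← hku, he])
  let T : Set V := Set.range k
  have hsurj : ∀ b ∈ X.image u, ∃ m, u (k m) = b := by
    have : Finset.univ.image (fun m => u (k m)) = X.image u := by
      refine Finset.eq_of_subset_of_card_le ?_ ?_
      · intro b hb
        obtain ⟨m, _, rfl⟩ := Finset.mem_image.1 hb
        exact Finset.mem_image_of_mem u (hkX m)
      · rw [Finset.card_image_of_injective _ (fun m m' he => huk m m' he), heq]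
        simp
    intro b hb
    rw [← this] at hb
    obtain ⟨m, _, hm⟩ := Finset.mem_image.1 hb
    exact ⟨m, hm⟩
  -- among two half-edges at a vertex, or of an edge, exactly one is chosen
  have hTu : ∀ x ∈ X, ∀ y ∈ X, x ≠ y → u x = u y → (y ∈ T ↔ x ∉ T) := by
    intro x hx y hy hxy huxy
    constructor
    · rintro ⟨m, rfl⟩ ⟨m', rfl⟩
      exact hxy (by rw [huk _ _ huxy])
    · intro hxT
      obtain ⟨m, hm⟩ := hsurj (u x) (Finset.mem_image_of_mem u hx)
      by_contra hyT
      have h2 := hfib (u x) (Finset.mem_image_of_mem u hx)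
      have h3 : ({x, y, k m} : Finset V) ⊆ X.filter (fun z => u z = u x) := by
        intro z
        simp only [Finset.mem_insert, Finset.mem_singleton, Finset.mem_filter]
        rintro (rfl | rfl | rfl)
        exacts [⟨hx, rfl⟩, ⟨hy, huxy.symm⟩, ⟨hkX m, hm⟩]
      have h4 := Finset.card_le_card h3
      rw [Finset.card_eq_three.2 ⟨x, y, k m, hxy, fun h => hxT ⟨m, h.symm⟩,
        fun h => hyT ⟨m, h.symm⟩, rfl⟩] at h4
      omega
  have hTN : ∀ m ∈ M', ∀ x ∈ N m, ∀ y ∈ N m, x ≠ y → (y ∈ T ↔ x ∉ T) := by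
    intro m hm x hx y hy hxy
    have hkm : ∀ z ∈ N m, z ∈ T → z = k ⟨m, hm⟩ := by
      rintro z hz ⟨m', rfl⟩
      have : m' = ⟨m, hm⟩ := Subtype.ext (hdis _ (hsub m'.2) _ (hsub hm) _ (hkN m') hz)
      rw [this]
    constructor
    · intro hyT hxT
      exact hxy ((hkm x hx hxT).trans (hkm y hy hyT).symm)
    · intro hxT
      by_contra hyT
      have h3 : ({x, y, k ⟨m, hm⟩} : Finset V) ⊆ N m := by
        intro z
        simp only [Finset.mem_insert, Finset.mem_singleton]
        rintro (rfl | rfl | rfl)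
        exacts [hx, hy, hkN ⟨m, hm⟩]
      have h4 := Finset.card_le_card h3
      rw [Finset.card_eq_three.2 ⟨x, y, k ⟨m, hm⟩, hxy, fun h => hxT ⟨_, h.symm⟩,
        fun h => hyT ⟨_, h.symm⟩, rfl⟩, hN m (hsub hm)] at h4
      omega
  have hp : ∀ x, ∃ y, x ∈ X → y ∈ X ∧ y ≠ x ∧ u y = u x ∧
      ∀ z ∈ X, z ≠ x → u z = u x → z = y := by
    intro x
    by_cases hx : x ∈ X
    · have h2 := hfib (u x) (Finset.mem_image_of_mem u hx)
      have hxf : x ∈ X.filter (fun y => u y = u x) := by simp [hx]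
      have h3 : ((X.filter (fun y => u y = u x)).erase x).card = 1 := by
        rw [Finset.card_erase_of_mem hxf, h2]
      obtain ⟨y, hy⟩ := Finset.card_eq_one.1 h3
      have hy1 : ∀ z, z ∈ X → z ≠ x → u z = u x → z = y := fun z hz hzx hu =>
        Finset.mem_singleton.1 (hy ▸ Finset.mem_erase.2 ⟨hzx, by simp [hz, hu]⟩)
      have hy2 : y ∈ (X.filter (fun y => u y = u x)).erase x := hy ▸ Finset.mem_singleton_self y
      simp only [Finset.mem_erase, Finset.mem_filter] at hy2
      exact ⟨y, fun _ => ⟨hy2.2.1, hy2.1, hy2.2.2, hy1⟩⟩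
    · exact ⟨x, fun h => absurd h hx⟩
  have hq : ∀ x, ∃ y, x ∈ X → ∃ m ∈ M', x ∈ N m ∧ y ∈ N m ∧ y ≠ x ∧
      ∀ z ∈ N m, z ≠ x → z = y := by
    intro x
    by_cases hx : x ∈ X
    · obtain ⟨m, hm, hxm⟩ := Finset.mem_biUnion.1 hx
      have h3 : ((N m).erase x).card = 1 := by
        rw [Finset.card_erase_of_mem hxm, hN m (hsub hm)]
      obtain ⟨y, hy⟩ := Finset.card_eq_one.1 h3
      have hy2 : y ∈ (N m).erase x := hy ▸ Finset.mem_singleton_self y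
      exact ⟨y, fun _ => ⟨m, hm, hxm, Finset.mem_of_mem_erase hy2, Finset.ne_of_mem_erase hy2,
        fun z hz hzx => Finset.mem_singleton.1 (hy ▸ Finset.mem_erase.2 ⟨hzx, hz⟩)⟩⟩
    · exact ⟨x, fun h => absurd h hx⟩
  choose p hp using hp
  choose q hq using hq
  -- The map walks along the cycles: from a chosen half-edge to the other one at its vertex, from an
  -- unchosen one to the other half of its edge.
  refine ⟨fun x => if x ∈ T then p x else q x, T, ?_, ?_, ?_, ?_⟩
  · exact fun x hx => hfib _ (Finset.mem_image_of_mem u hx)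
  · intro x hx
    dsimp only
    split_ifs with hxT
    · obtain ⟨h1, h2, h3, -⟩ := hp x hx
      exact hTu x hx (p x) h1 h2.symm h3.symm
    · obtain ⟨m, hm, h1, h2, h3, -⟩ := hq x hx
      exact hTN m hm x h1 (q x) h2 h3.symm
  · intro x hx y hy hxy huxy
    have h1 := hTu x hx y hy hxy huxy
    by_cases hxT : x ∈ T
    · left
      dsimp only
      rw [if_pos hxT]
      exact ((hp x hx).2.2.2 y hy hxy.symm huxy.symm).symm
    · right
      dsimp only
      rw [if_pos (h1.2 hxT)]
      exact ((hp y hy).2.2.2 x hx hxy huxy).symm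
  · intro m hm x hx y hy hxy
    have h1 := hTN m hm x hx y hy hxy
    have aux : ∀ a ∈ N m, ∀ b ∈ N m, b ≠ a → b = q a := by
      intro a ha b hb hba
      obtain ⟨m', hm', h2, -, -, h4⟩ := hq a (Finset.mem_biUnion.2 ⟨m, hm, ha⟩)
      have := hdis m (hsub hm) m' (hsub hm') a ha h2
      subst this
      exact h4 b hb hba
    by_cases hxT : x ∈ T
    · right
      dsimp only
      rw [if_neg (by tauto)]
      exact (aux y hy x hx hxy).symm
    · left
      dsimp only
      rw [if_neg hxT]
      exact (aux x hx y hy hxy.symm).symm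

end

/-! ### Middle vertices and the 6-vertices that pay for them. -/

section
variable {V : Type u} [Fintype V] {G : SimpleGraph V} {C : Type w} {L : V → Finset C}

open Classical in
theorem exists_other_nbr {x m : V} (hx : G.degree x = 2) (hm : G.Adj x m) :
    ∃ z, z ≠ m ∧ G.Adj x z ∧ (∀ y, G.Adj x y → y = m ∨ y = z) ∧
      G.nbrSum x = G.degree m + G.degree z := by
  have h1 : ((G.neighborFinset x).erase m).card = 1 := by
    rw [Finset.card_erase_of_mem (by simpa using hm), card_neighborFinset_eq_degree, hx]
  obtain ⟨z, hz⟩ := Finset.card_eq_one.1 h1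
  have hz' : z ∈ (G.neighborFinset x).erase m := hz ▸ Finset.mem_singleton_self z
  have hN : G.neighborFinset x = insert m {z} := by
    rw [← hz, Finset.insert_erase (by simpa using hm)]
  refine ⟨z, Finset.ne_of_mem_erase hz', by simpa using Finset.mem_of_mem_erase hz', ?_, ?_⟩
  · intro y hy
    have : y ∈ G.neighborFinset x := by simpa using hy
    rw [hN] at this
    simpa using this
  · rw [nbrSum, hN, Finset.sum_insert (by simpa using (Finset.ne_of_mem_erase hz').symm),
      Finset.sum_singleton]

open Classical in
/-- The vertices of degree two both of whose neighbors have degree two. -/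
noncomputable def middles (G : SimpleGraph V) : Finset V :=
  Finset.univ.filter fun m => G.degree m = 2 ∧ ∀ x, G.Adj m x → G.degree x = 2

theorem mem_middles [DecidableRel G.Adj] {m : V} :
    m ∈ G.middles ↔ G.degree m = 2 ∧ ∀ x, G.Adj m x → G.degree x = 2 := by
  simp only [middles, Finset.mem_filter, Finset.mem_univ, true_and]
  convert Iff.rfl

open Classical in
theorem nbrSum_of_mem_middles {m : V} (hm : m ∈ G.middles) : G.nbrSum m = 4 := by
  obtain ⟨h1, h2⟩ := mem_middles.1 hm
  rw [nbrSum, Finset.sum_congr rfl (fun x hx => h2 x (by simpa using hx)), Finset.sum_const,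
    card_neighborFinset_eq_degree, h1]
  rfl

open Classical in
theorem ColorableOff.of_subset_middles (hL : ∀ x, 7 ≤ (L x).card) :
    ∀ A ⊆ G.middles, G.ColorableOff L A → G.ColorableOff L ∅ := by
  intro A
  induction A using Finset.induction with
  | empty => exact fun _ h => h
  | insert m A _ ih =>
    intro hA h
    refine ih (fun x hx => hA (Finset.mem_insert_of_mem hx)) (h.of_insert ?_)
    have h1 := nbrSum_of_mem_middles (hA (Finset.mem_insert_self m A))
    have h2 := card_sqNbr_le (G := G) m
    have h3 : (G.sqNbr m \ A).card ≤ (G.sqNbr m).card := Finset.card_le_card Finset.sdiff_subset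
    have := hL m
    omega

open Classical in
/-- There are at most as many paths of three vertices of degree two as vertices of degree six. -/
theorem IsCritical.card_middles_le (h : G.IsCritical L) (hΔ : ∀ v, G.degree v ≤ 6) :
    G.middles.card ≤ (Finset.univ.filter fun v => G.degree v = 6).card := by
  by_contra! hlt
  have hu : ∀ x, ∃ z, ∀ m ∈ G.middles, G.Adj m x →
      G.degree z = 6 ∧ G.Adj x z ∧ ∀ y, G.Adj x y → y = m ∨ y = z := by
    intro x
    by_cases hx : ∃ m ∈ G.middles, G.Adj m x
    · obtain ⟨m, hm, hmx⟩ := hx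
      obtain ⟨z, hzm, hxz, hz, hsum⟩ := exists_other_nbr ((mem_middles.1 hm).2 x hmx) hmx.symm
      rw [(mem_middles.1 hm).1] at hsum
      -- If `z` had degree at most 5, then `nbrSum x ≤ 7` and `nbrSum m = 4`, so the edge `x m`
      -- would be reducible.
      have hz6 : G.degree z = 6 := by
        by_contra hne
        have := hΔ z
        have := h.lt_nbrSum_of_adj hmx.symm (by omega)
        rw [nbrSum_of_mem_middles hm] at this
        omega
      refine ⟨z, fun m' hm' hmx' => ⟨hz6, hxz, ?_⟩⟩
      rcases hz m' hmx'.symm with rfl | rfl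
      · exact hz
      · have := (mem_middles.1 hm').1
        omega
    · exact ⟨x, fun m hm hmx => absurd ⟨m, hm, hmx⟩ hx⟩
  choose u hu using hu
  have huniq : ∀ m ∈ G.middles, ∀ m' ∈ G.middles, ∀ x,
      x ∈ G.neighborFinset m → x ∈ G.neighborFinset m' → m = m' := by
    intro m hm m' hm' x hx hx'
    rw [mem_neighborFinset] at hx hx'
    obtain ⟨h1, h2, h3⟩ := hu x m' hm' hx'
    rcases h3 m hx.symm with h4 | h4
    · exact h4
    · have := (mem_middles.1 hm).1
      rw [h4] at this
      omega
  obtain ⟨M, hsub, hne, g, T, hfib, hgT, hgu, hgN⟩ := exists_alternating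
    (fun m => G.neighborFinset m) u G.middles (fun m hm => (mem_middles.1 hm).1) huniq
    (Finset.card_pos.1 (by omega)) (by
      refine (Finset.card_le_card ?_).trans hlt.le
      intro b hb
      obtain ⟨x, hx, rfl⟩ := Finset.mem_image.1 hb
      obtain ⟨m, hm, hmx⟩ := Finset.mem_biUnion.1 hx
      simpa using (hu x m hm (by simpa using hmx)).1)
  set X := M.biUnion (fun m => G.neighborFinset m) with hX
  have hXm : ∀ x ∈ X, ∃ m ∈ M, G.Adj m x := by
    intro x hx
    obtain ⟨m, hm, hmx⟩ := Finset.mem_biUnion.1 hx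
    exact ⟨m, hm, by simpa using hmx⟩
  have hmX : ∀ m ∈ M, ∀ x, G.Adj m x → x ∈ X := fun m hm x hmx =>
    Finset.mem_biUnion.2 ⟨m, hm, by simpa using hmx⟩
  have hX2 : ∀ x ∈ X, G.degree x = 2 := by
    intro x hx
    obtain ⟨m, hm, hmx⟩ := hXm x hx
    exact (mem_middles.1 (hsub hm)).2 x hmx
  have hXM : ∀ x ∈ X, x ∉ M := by
    intro x hx hxM
    obtain ⟨m, hm, hmx⟩ := hXm x hx
    obtain ⟨h1, h2, -⟩ := hu x m (hsub hm) hmx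
    have := (mem_middles.1 (hsub hxM)).2 _ h2
    omega
  have hsq : ∀ x ∈ X, ∀ y, y ∉ M → G.square.Adj x y →
      y = u x ∨ G.Adj (u x) y ∨ ∃ m ∈ M, G.Adj m x ∧ G.Adj m y := by
    intro x hx y hy hxy
    obtain ⟨m, hm, hmx⟩ := hXm x hx
    obtain ⟨-, h2, h3⟩ := hu x m (hsub hm) hmx
    obtain ⟨hne, h4 | ⟨z, h4, h5⟩⟩ := (square_adj_iff G).1 hxy
    · rcases h3 y h4 with rfl | h5
      · exact absurd hm hy
      · exact Or.inl h5
    · rcases h3 z h4 with rfl | rfl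
      · exact Or.inr (Or.inr ⟨z, hm, hmx, h5⟩)
      · exact Or.inr (Or.inl h5)
  -- Only `u x` and its neighbors outside `X` remain colored near `x`: 1 + (6 - 2) vertices, leaving
  -- two of the seven colors.
  have hcard : ∀ x ∈ X, (G.sqNbr x \ (X ∪ M)).card ≤ 5 := by
    intro x hx
    obtain ⟨m, hm, hmx⟩ := hXm x hx
    obtain ⟨h1, h2, -⟩ := hu x m (hsub hm) hmx
    have hF : X.filter (fun y => u y = u x) ⊆ G.neighborFinset (u x) := by
      intro y hy
      obtain ⟨hyX, hyu⟩ := Finset.mem_filter.1 hy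
      obtain ⟨m', hm', hmy⟩ := hXm y hyX
      rw [mem_neighborFinset, ← hyu]
      exact (hu y m' (hsub hm') hmy).2.1.symm
    have hsub2 : G.sqNbr x \ (X ∪ M) ⊆
        insert (u x) (G.neighborFinset (u x) \ X.filter (fun y => u y = u x)) := by
      intro y hy
      simp only [Finset.mem_sdiff, mem_sqNbr, Finset.mem_union, not_or] at hy
      rcases hsq x hx y hy.2.2 hy.1 with h3 | h3 | ⟨m', hm', -, h3⟩
      · simp [h3]
      · simp [h3, hy.2.1]
      · exact absurd (hmX m' hm' y h3) hy.2.1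
    refine (Finset.card_le_card hsub2).trans ((Finset.card_insert_le _ _).trans ?_)
    rw [Finset.card_sdiff_of_subset hF, hfib x hx, card_neighborFinset_eq_degree, h1]
  obtain ⟨m₀, hm₀⟩ := hne
  obtain ⟨x₀, hx₀⟩ := (G.degree_pos_iff_exists_adj m₀).1
    (by rw [(mem_middles.1 (hsub hm₀)).1]; norm_num)
  obtain ⟨φ, hφL, hφ⟩ := h.off_of_adj (X ∪ M) m₀ (by simp [hm₀]) x₀
    (by simp [hmX m₀ hm₀ x₀ hx₀]) hx₀
  have hlist : ∀ x ∈ X, 2 ≤ (L x \ (G.sqNbr x \ (X ∪ M)).image φ).card := by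
    intro x hx
    have h1 := Finset.le_card_sdiff ((G.sqNbr x \ (X ∪ M)).image φ) (L x)
    have h2 := Finset.card_image_le (s := G.sqNbr x \ (X ∪ M)) (f := φ)
    have := hcard x hx
    have := h.card_le x
    omega
  obtain ⟨ψ, hψ⟩ := exists_choice_ne_map g T φ X
    (fun x => L x \ (G.sqNbr x \ (X ∪ M)).image φ) hgT
    (fun x hx => (hlist x hx).trans' (by norm_num)) (fun x hx _ => hlist x hx)
  have hψne : ∀ x ∈ X, ∀ y ∈ X, g x = y ∨ g y = x → ψ x ≠ ψ y := by
    rintro x hx y hy (h1 | h1)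
    · have := (hψ x hx).2 (h1 ▸ hy)
      rwa [h1] at this
    · have := (hψ y hy).2 (h1 ▸ hx)
      rw [h1] at this
      exact this.symm
  have hψφ : ∀ x ∈ X, ∀ y, y ∉ X → y ∉ M → G.square.Adj x y → ψ x ≠ φ y := by
    intro x hx y hy hyM hxy he
    refine (Finset.mem_sdiff.1 (hψ x hx).1).2 (Finset.mem_image.2 ⟨y, ?_, he.symm⟩)
    simp [mem_sqNbr, hxy, hy, hyM]
  -- Conflicts inside `X` come from a common 6-vertex or a common middle vertex, and `g` covers both
  -- kinds. The middle vertices are colored last, each having at most 4 neighbors in the square.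
  refine h.not_colorable (ColorableOff.of_subset_middles h.card_le M hsub
    ⟨fun x => if x ∈ X then ψ x else φ x, fun x => ?_, fun x y hx hy hxy => ?_⟩)
  · dsimp only
    split_ifs with hx
    · exact (Finset.mem_sdiff.1 (hψ x hx).1).1
    · exact hφL x
  · dsimp only
    split_ifs with hxX hyX hyX
    · refine hψne x hxX y hyX ?_
      rcases hsq x hxX y hy hxy with h1 | h1 | ⟨m, hm, h1, h2⟩
      · obtain ⟨m, hm, hmx⟩ := hXm x hxX
        have h2 := (hu x m (hsub hm) hmx).1
        rw [← h1, hX2 y hyX] at h2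
        omega
      · obtain ⟨m, hm, hmx⟩ := hXm x hxX
        obtain ⟨m', hm', hmy⟩ := hXm y hyX
        obtain ⟨h2, -, -⟩ := hu x m (hsub hm) hmx
        obtain ⟨-, -, h3⟩ := hu y m' (hsub hm') hmy
        refine hgu x hxX y hyX hxy.ne ?_
        rcases h3 _ h1.symm with h4 | h4
        · have := (mem_middles.1 (hsub hm')).1
          rw [← h4] at this
          omega
        · exact h4
      · exact hgN m hm x (by simpa using h1) y (by simpa using h2) hxy.ne
    · exact hψφ x hxX y hyX hy hxy
    · exact (hψφ y hyX x hxX hx hxy.symm).symm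
    · exact hφ x y (by simp [hxX, hx]) (by simp [hyX, hy]) hxy

end

/-! ### Discharging. -/

section
variable {V : Type u} [Fintype V] {G : SimpleGraph V} {C : Type w} {L : V → Finset C}

open Classical in
/-- The charge (in quarters) that `v` gives to its neighbor `x`. -/
noncomputable def give (G : SimpleGraph V) (v x : V) : ℤ :=
  if 5 ≤ G.degree v then if G.degree x ≤ 3 then 2 else 0
  else if 3 ≤ G.degree v ∧ G.degree x = 2 then
    -- When `x` is a 2-vertex adjacent to `v`, the thresholds say that its other neighbor has degree
    -- at most 2, respectively at most 4.
    if G.nbrSum x ≤ G.degree v + 2 then 2 else if G.nbrSum x ≤ G.degree v + 4 then 1 else 0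
  else 0

theorem give_nonneg (v x : V) : 0 ≤ G.give v x := by
  unfold give; split_ifs <;> norm_num

theorem give_le_two (v x : V) : G.give v x ≤ 2 := by
  unfold give; split_ifs <;> norm_num

section
open Classical

theorem give_of_five_le {v x : V} (hv : 5 ≤ G.degree v) (hx : G.degree x ≤ 3) :
    G.give v x = 2 := by
  rw [give, if_pos hv, if_pos hx]

theorem give_of_degree_ne_two {v x : V} (hv : G.degree v ≤ 4) (hx : G.degree x ≠ 2) :
    G.give v x = 0 := by
  rw [give, if_neg (by omega), if_neg (by tauto)]

theorem give_of_degree_two {v x : V} (hv : G.degree v = 2) : G.give v x = 0 := by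
  rw [give, if_neg (by omega), if_neg (by omega)]

theorem nbrSum_le_of_give_pos {v x : V} (hv : G.degree v ≤ 4) (h : 0 < G.give v x) :
    G.nbrSum x ≤ G.degree v + 4 := by
  unfold give at h
  split_ifs at h <;> omega

theorem nbrSum_le_of_one_lt_give {v x : V} (hv : G.degree v ≤ 4) (h : 1 < G.give v x) :
    G.nbrSum x ≤ G.degree v + 2 := by
  unfold give at h
  split_ifs at h <;> omega

theorem IsCritical.two_le_degree (h : G.IsCritical L) {v : V} (hv : G.degree v ≠ 0) :
    2 ≤ G.degree v := by
  by_contra! hlt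
  obtain ⟨u, hu⟩ := Finset.card_eq_one.1
    (by rw [card_neighborFinset_eq_degree]; omega : (G.neighborFinset v).card = 1)
  refine h.degree_ne_one v u fun x => ?_
  rw [← mem_neighborFinset, hu, Finset.mem_singleton]

theorem IsCritical.two_le_degree_of_adj (h : G.IsCritical L) {v x : V} (hvx : G.Adj v x) :
    2 ≤ G.degree x :=
  h.two_le_degree ((G.degree_pos_iff_exists_adj x).2 ⟨v, hvx.symm⟩).ne'

/-- If `v` with small `nbrSum` gives 2 to a neighbor of degree two, its other neighbors have
large `nbrSum`. -/
theorem IsCritical.seven_lt_nbrSum (h : G.IsCritical L) (hΔ : ∀ v, G.degree v ≤ 6) {v a b : V}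
    (hv : G.degree v ≤ 4) (hva : G.Adj v a) (hvb : G.Adj v b) (hab : a ≠ b)
    (ha : G.degree a = 2) (hs : G.nbrSum v ≤ 8) (hga : 1 < G.give v a) : 7 < G.nbrSum b := by
  by_contra! hb
  have h1 := nbrSum_le_of_one_lt_give hv hga
  obtain ⟨x, hxv, hax, -, hsum⟩ := exists_other_nbr ha hva.symm
  have hx := h.two_le_degree_of_adj hax
  obtain ⟨y, -, -, -, hy⟩ := exists_other_nbr (by omega : G.degree x = 2) hax.symm
  have := hΔ y
  -- Here `x` has degree 2, so `nbrSum x ≤ 2 + 6` and `nbrSum a ≤ 4 + 2`: the path `x a v b` would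
  -- be reducible.
  have := h.path_irreducible hax.symm hva.symm hvb hxv hab (by omega) hs hb
  omega

/-- The deficit is 2. It is met by the pot if both neighbors have degree 2, by a single neighbor if
exactly one does, and otherwise by one neighbor of degree at least 5 or by two gifts of 1. -/
theorem IsCritical.charge_degree_two (h : G.IsCritical L) {v : V} (hv : G.degree v = 2) :
    2 ≤ ∑ x ∈ G.neighborFinset v, G.give x v + if v ∈ G.middles then 2 else 0 := by
  obtain ⟨a, b, hab, hN⟩ := Finset.card_eq_two.1 hv
  have hva : G.Adj v a := by rw [← mem_neighborFinset, hN]; simp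
  have hvb : G.Adj v b := by rw [← mem_neighborFinset, hN]; simp
  have ha := h.two_le_degree_of_adj hva
  have hb := h.two_le_degree_of_adj hvb
  have hs : G.nbrSum v = G.degree a + G.degree b := by
    rw [nbrSum, hN, Finset.sum_pair hab]
  rw [hN, Finset.sum_pair hab]
  have ha0 := G.give_nonneg a v
  have hb0 := G.give_nonneg b v
  have hm : (0 : ℤ) ≤ if v ∈ G.middles then 2 else 0 := by split_ifs <;> norm_num
  by_cases ha2 : G.degree a = 2 <;> by_cases hb2 : G.degree b = 2
  · have : v ∈ G.middles := mem_middles.2 ⟨hv, fun x hx => by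
      rw [← mem_neighborFinset, hN] at hx
      simp only [Finset.mem_insert, Finset.mem_singleton] at hx
      rcases hx with rfl | rfl
      exacts [ha2, hb2]⟩
    rw [if_pos this] at hm ⊢
    omega
  · have : G.give b v = 2 := by
      unfold give
      split_ifs <;> omega
    omega
  · have : G.give a v = 2 := by
      unfold give
      split_ifs <;> omega
    omega
  · have : 2 ≤ G.give a v + G.give b v := by
      unfold give
      split_ifs <;> omega
    omega

/-- With three 2-neighbors, `nbrSum v = 6` and nothing is given, by reducibility of edges. With two,
a third neighbor of degree at least 5 pays 2 back, and otherwise `seven_lt_nbrSum` stops `v` from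
giving more than 2 in all. -/
theorem IsCritical.charge_degree_three (h : G.IsCritical L) (hΔ : ∀ v, G.degree v ≤ 6) {v : V}
    (hv : G.degree v = 3) :
    ∑ x ∈ G.neighborFinset v, G.give v x ≤ 2 + ∑ x ∈ G.neighborFinset v, G.give x v := by
  obtain ⟨a, b, c, hab, hac, hbc, hN⟩ := Finset.card_eq_three.1 hv
  have hadj : ∀ x, G.Adj v x ↔ x = a ∨ x = b ∨ x = c := fun x => by
    rw [← mem_neighborFinset, hN]; simp
  have hva := (hadj a).2 (by simp)
  have hvb := (hadj b).2 (by simp)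
  have hvc := (hadj c).2 (by simp)
  have hsum : ∀ f : V → ℤ, ∑ x ∈ G.neighborFinset v, f x = f a + f b + f c := fun f => by
    rw [hN, Finset.sum_insert (by simp [hab, hac]), Finset.sum_pair hbc, add_assoc]
  have hs : G.nbrSum v = G.degree a + G.degree b + G.degree c := by
    rw [nbrSum, hN, Finset.sum_insert (by simp [hab, hac]), Finset.sum_pair hbc, add_assoc]
  rw [hsum, hsum]
  have key : ∀ x y z : V, G.Adj v x → G.Adj v y → x ≠ y →
      G.nbrSum v = G.degree x + G.degree y + G.degree z →
      G.degree x = 2 → G.degree y = 2 → G.degree z ≤ 4 →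
      1 < G.give v x → G.give v y ≤ 0 := by
    intro x y z hx hy hxy hs hx2 hy2 hz hg
    by_contra! hpos
    have h1 := nbrSum_le_of_give_pos (by omega) hpos
    have h2 := h.seven_lt_nbrSum hΔ (by omega) hx hy hxy hx2 (by omega) hg
    omega
  have key3 : ∀ x, G.Adj v x → G.nbrSum v ≤ 6 → G.give v x ≤ 0 := by
    intro x hx hs6
    by_contra! hpos
    have h1 := nbrSum_le_of_give_pos (by omega) hpos
    have h2 := h.lt_nbrSum_of_adj hx.symm (by omega)
    omega
  have hpair : ∀ x y z : V, G.Adj v x → G.Adj v y → x ≠ y →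
      G.nbrSum v = G.degree x + G.degree y + G.degree z →
      G.degree x = 2 → G.degree y = 2 → G.degree z ≠ 2 →
      G.give v x + G.give v y ≤ 2 + G.give z v := by
    intro x y z hx hy hxy hs hx2 hy2 hz2
    have h1 := G.give_le_two v x
    have h2 := G.give_le_two v y
    have h3 := G.give_nonneg z v
    by_cases hz : G.degree z ≤ 4
    · have h4 := key x y z hx hy hxy hs hx2 hy2 hz
      have h5 := key y x z hy hx hxy.symm (by omega) hy2 hx2 hz
      by_cases h6 : 1 < G.give v x
      · have := h4 h6
        omega
      · by_cases h7 : 1 < G.give v y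
        · have := h5 h7
          omega
        · omega
    · have := give_of_five_le (by omega : 5 ≤ G.degree z) hv.le
      omega
  have h0 : ∀ x, G.degree x ≠ 2 → G.give v x = 0 := fun x hx =>
    give_of_degree_ne_two (by omega) hx
  have hna := G.give_nonneg a v
  have hnb := G.give_nonneg b v
  have hnc := G.give_nonneg c v
  have hla := G.give_le_two v a
  have hlb := G.give_le_two v b
  have hlc := G.give_le_two v c
  by_cases ha : G.degree a = 2 <;> by_cases hb : G.degree b = 2 <;> by_cases hc : G.degree c = 2
  · have := key3 a hva (by omega)
    have := key3 b hvb (by omega)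
    have := key3 c hvc (by omega)
    omega
  · have := hpair a b c hva hvb hab (by omega) ha hb hc
    have := h0 c hc
    omega
  · have := hpair a c b hva hvc hac (by omega) ha hc hb
    have := h0 b hb
    omega
  · have := h0 b hb
    have := h0 c hc
    omega
  · have := hpair b c a hvb hvc hbc (by omega) hb hc ha
    have := h0 a ha
    omega
  · have := h0 a ha
    have := h0 c hc
    omega
  · have := h0 a ha
    have := h0 b hb
    omega
  · have := h0 a ha
    have := h0 b hb
    have := h0 c hc
    omega

theorem sum_give_le (v : V) (A : Finset V) : ∑ x ∈ A, G.give v x ≤ 2 * A.card := by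
  refine (Finset.sum_le_card_nsmul A _ 2 fun x _ => give_le_two v x).trans_eq ?_
  rw [nsmul_eq_mul, mul_comm]

/-- A neighbor of degree other than 2 receives nothing, leaving at most three gifts of 2. If all
neighbors have degree 2, at most one of them receives 2. -/
theorem IsCritical.charge_degree_four (h : G.IsCritical L) (hΔ : ∀ v, G.degree v ≤ 6) {v : V}
    (hv : G.degree v = 4) : ∑ x ∈ G.neighborFinset v, G.give v x ≤ 6 := by
  by_cases hall : ∀ x ∈ G.neighborFinset v, G.degree x = 2
  · have hs : G.nbrSum v = 8 := by
      rw [nbrSum, Finset.sum_congr rfl hall, Finset.sum_const, card_neighborFinset_eq_degree, hv]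
      rfl
    have hle : ∀ A : Finset V, (∀ x ∈ A, G.give v x ≤ 1) → ∑ x ∈ A, G.give v x ≤ A.card := by
      intro A hA
      simpa using Finset.sum_le_card_nsmul A _ 1 hA
    by_cases hex : ∃ a ∈ G.neighborFinset v, 1 < G.give v a
    · obtain ⟨a, ha, hga⟩ := hex
      rw [← Finset.add_sum_erase _ _ ha]
      have h1 := hle ((G.neighborFinset v).erase a) (fun b hb => by
        by_contra! hgb
        have hb' := Finset.mem_of_mem_erase hb
        have h2 := h.seven_lt_nbrSum hΔ hv.le (by simpa using ha) (by simpa using hb')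
          (Finset.ne_of_mem_erase hb).symm (hall a ha) hs.le hga
        have := nbrSum_le_of_one_lt_give hv.le hgb
        omega)
      rw [Finset.card_erase_of_mem ha, card_neighborFinset_eq_degree, hv] at h1
      have := G.give_le_two v a
      push_cast at h1
      omega
    · push Not at hex
      have h1 := hle _ hex
      rw [card_neighborFinset_eq_degree, hv] at h1
      push_cast at h1
      omega
  · push Not at hall
    obtain ⟨c, hc, hc2⟩ := hall
    rw [← Finset.add_sum_erase _ _ hc, give_of_degree_ne_two hv.le hc2]
    have h1 := sum_give_le (G := G) v ((G.neighborFinset v).erase c)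
    rw [Finset.card_erase_of_mem hc, card_neighborFinset_eq_degree, hv] at h1
    push_cast at h1
    omega

/-- The summands are the initial charge, the net local transfer and the net draw from the pot.
Degrees 5 and 6 balance because 10 = 5 · 2 and 14 = 6 · 2 + 2. -/
theorem IsCritical.charge_nonneg (h : G.IsCritical L) (hΔ : ∀ v, G.degree v ≤ 6) (v : V) :
    0 ≤ (if G.degree v ≠ 0 then 4 * (G.degree v : ℤ) - 10 else 0)
      + ((∑ x ∈ G.neighborFinset v, G.give x v) - ∑ x ∈ G.neighborFinset v, G.give v x)
      + ((if v ∈ G.middles then 2 else 0) - if G.degree v = 6 then 2 else 0) := by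
  have hin : 0 ≤ ∑ x ∈ G.neighborFinset v, G.give x v :=
    Finset.sum_nonneg fun x _ => give_nonneg x v
  have hout := sum_give_le (G := G) v (G.neighborFinset v)
  rw [card_neighborFinset_eq_degree] at hout
  have hm : (0 : ℤ) ≤ if v ∈ G.middles then 2 else 0 := by split_ifs <;> norm_num
  have h6 := hΔ v
  by_cases hv : G.degree v = 0
  · rw [if_neg (by simpa using hv), if_neg (by omega : ¬ G.degree v = 6)]
    rw [hv] at hout
    push_cast at hout
    omega
  rw [if_pos hv]
  have h2 := h.two_le_degree hv
  obtain h3 | h3 | h3 | h3 | h3 : G.degree v = 2 ∨ G.degree v = 3 ∨ G.degree v = 4 ∨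
      G.degree v = 5 ∨ G.degree v = 6 := by omega
  · have h4 := h.charge_degree_two h3
    rw [Finset.sum_eq_zero (fun x _ => give_of_degree_two h3), h3]
    norm_num
    omega
  · have h4 := h.charge_degree_three hΔ h3
    rw [h3]
    norm_num
    omega
  · have h4 := h.charge_degree_four hΔ h3
    rw [h3]
    norm_num
    omega
  · rw [h3] at hout ⊢
    norm_num at hout ⊢
    omega
  · rw [h3] at hout ⊢
    norm_num at hout ⊢
    omega

theorem IsCritical.le_sum_degree (h : G.IsCritical L) (hΔ : ∀ v, G.degree v ≤ 6) :
    5 * (Finset.univ.filter fun v => G.degree v ≠ 0).card ≤ 2 * ∑ v, G.degree v := by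
  have h0 := Finset.sum_nonneg fun v (_ : v ∈ Finset.univ) => h.charge_nonneg hΔ v
  rw [Finset.sum_add_distrib, Finset.sum_add_distrib, Finset.sum_sub_distrib,
    Finset.sum_sub_distrib] at h0
  have hcomm : ∑ v, ∑ x ∈ G.neighborFinset v, G.give x v =
      ∑ v, ∑ x ∈ G.neighborFinset v, G.give v x := by
    simp only [neighborFinset_eq_filter, Finset.sum_filter]
    rw [Finset.sum_comm]
    simp only [G.adj_comm]
  have hmid : ∑ v, (if v ∈ G.middles then (2 : ℤ) else 0) = 2 * G.middles.card := by
    rw [← Finset.sum_filter, Finset.sum_const, nsmul_eq_mul, mul_comm]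
    simp
  have hsix : ∑ v, (if G.degree v = 6 then (2 : ℤ) else 0) =
      2 * (Finset.univ.filter fun v => G.degree v = 6).card := by
    rw [← Finset.sum_filter, Finset.sum_const, nsmul_eq_mul, mul_comm]
  have hdeg : ∑ v, (if G.degree v ≠ 0 then 4 * (G.degree v : ℤ) - 10 else 0) =
      4 * ∑ v, (G.degree v : ℤ) - 10 * (Finset.univ.filter fun v => G.degree v ≠ 0).card := by
    rw [Finset.mul_sum, ← Finset.sum_filter, Finset.sum_sub_distrib, Finset.sum_const,
      nsmul_eq_mul, mul_comm (10 : ℤ)]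
    congr 1
    refine Finset.sum_subset (Finset.filter_subset _ _) fun v _ hv => ?_
    simp only [Finset.mem_filter, Finset.mem_univ, true_and, not_not] at hv
    simp [hv]
  have hle := Int.ofNat_le.2 (h.card_middles_le hΔ)
  rw [hcomm, hmid, hsix, hdeg] at h0
  refine Int.ofNat_le.1 ?_
  push_cast
  linarith

/-- Edge deletions may leave isolated vertices in `H`, so `mad` is tested on the subgraph formed by
the others. -/
theorem sum_degree_lt_of_mad_lt (hmad : G.mad < 5 / 2) {H : SimpleGraph V} (hH : H ≤ G)
    (hne : ∃ v, H.degree v ≠ 0) :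
    2 * ∑ v, H.degree v < 5 * (Finset.univ.filter fun v => H.degree v ≠ 0).card := by
  let K : G.Subgraph :=
    { verts := {v | H.degree v ≠ 0}
      Adj := H.Adj
      adj_sub := fun h => hH h
      edge_vert := fun {v w} h => ((H.degree_pos_iff_exists_adj v).2 ⟨w, h⟩).ne'
      symm := H.symm }
  have hK : K.verts.Nonempty := hne
  have h1 : 2 * (K.edgeSet.ncard : ℝ) / (K.verts.ncard : ℝ) ≤ G.mad :=
    le_ciSup (f := fun H : {H : G.Subgraph // H.verts.Nonempty} =>
      2 * (H.1.edgeSet.ncard : ℝ) / (H.1.verts.ncard : ℝ)) (Set.finite_range _).bddAbove ⟨K, hK⟩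
  have h2 : K.verts.ncard = (Finset.univ.filter fun v => H.degree v ≠ 0).card := by
    rw [← Set.ncard_coe_finset]
    congr 1
    ext v
    simp [K]
  have h3 : K.edgeSet = (H.edgeFinset : Set (Sym2 V)) := by
    rw [coe_edgeFinset]
    rfl
  have hpos : (0 : ℝ) < K.verts.ncard := by
    exact_mod_cast (Set.ncard_pos (Set.toFinite _)).2 hK
  have h4 := h1.trans_lt hmad
  rw [div_lt_div_iff₀ hpos (by norm_num), h3, Set.ncard_coe_finset, h2] at h4
  rw [sum_degrees_eq_twice_card_edges]
  have h5 : 2 * H.edgeFinset.card * 2 < 5 * (Finset.univ.filter fun v => H.degree v ≠ 0).card := by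
    exact_mod_cast h4
  omega

theorem isChoosable_square (hΔ : ∀ v, G.degree v ≤ 6) (hmad : G.mad < 5 / 2) :
    IsChoosable.{u, w} G.square 7 := by
  intro C L hL
  have main : ∀ H : SimpleGraph V, H ≤ G → H.ColorableOff L ∅ := by
    intro H
    induction H using WellFoundedLT.induction with
    | ind H ih =>
      intro hH
      have hΔH : ∀ v, H.degree v ≤ 6 := fun v => (degree_le_of_le hH).trans (hΔ v)
      by_contra hcol
      have hcrit := IsCritical.of_minimal hL hcol (fun K hK => ih K hK (hK.le.trans hH)) hΔH
      have h1 := hcrit.le_sum_degree hΔH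
      by_cases hne : ∃ v, H.degree v ≠ 0
      · have := sum_degree_lt_of_mad_lt hmad hH hne
        omega
      · push Not at hne
        have hno : ∀ x y, ¬ H.Adj x y := fun x y hxy =>
          ((H.degree_pos_iff_exists_adj x).2 ⟨y, hxy⟩).ne' (hne x)
        have hc : ∀ x, ∃ c, c ∈ L x := fun x =>
          Finset.card_pos.1 ((by norm_num : 0 < 7).trans_le (hL x))
        choose φ hφ using hc
        refine hcol ⟨φ, hφ, fun x y _ _ hxy => ?_⟩
        obtain ⟨-, h2 | ⟨z, h2, -⟩⟩ := (square_adj_iff H).1 hxy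
        exacts [absurd h2 (hno _ _), absurd h2 (hno _ _)]
  exact colorableOff_empty_iff.1 (main G le_rfl)

/-- With identical lists of `k` colors, the clique formed by `v` and its neighbors in the square
needs `deg v + 1` distinct colors. -/
theorem degree_lt_of_isChoosable_square {k : ℕ} (h : IsChoosable.{u, w} G.square k) (v : V) :
    G.degree v < k := by
  obtain ⟨φ, h1, -⟩ := h (ULift.{w} (Fin k)) (fun _ => Finset.univ) (by simp)
  have hinj : Set.InjOn φ (insert v (G.neighborFinset v) : Finset V) := by
    intro x hx y hy hxy
    by_contra hne
    refine h1 x y ((square_adj_iff G).2 ⟨hne, ?_⟩) hxy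
    simp only [Finset.coe_insert, Set.mem_insert_iff, Finset.mem_coe, mem_neighborFinset] at hx hy
    rcases hx with rfl | hx <;> rcases hy with rfl | hy
    · exact absurd rfl hne
    · exact Or.inl hy
    · exact Or.inl hx.symm
    · exact Or.inr ⟨v, hx.symm, hy⟩
  have hc := Finset.card_le_card (Finset.subset_univ ((insert v (G.neighborFinset v)).image φ))
  rw [Finset.card_image_of_injOn hinj, Finset.card_insert_of_notMem (by simp),
    card_neighborFinset_eq_degree] at hc
  simpa using hc

end
end
end SimpleGraph

theorem mainTheorem2 {V : Type u} [Fintype V] (G : SimpleGraph V) [DecidableRel G.Adj]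
    (hΔ : G.maxDegree ≤ 6) (hmad : G.mad < 5 / 2) :
    SimpleGraph.listChromaticNumber.{u, w} G.square ≤ 7 ∧
      (G.maxDegree = 6 → SimpleGraph.listChromaticNumber.{u, w} G.square = 7) := by
  have hle : SimpleGraph.listChromaticNumber.{u, w} G.square ≤ 7 := by
    refine iInf₂_le (7 : ℕ) (SimpleGraph.isChoosable_square (fun v => ?_) hmad)
    refine le_trans ?_ ((G.degree_le_maxDegree v).trans hΔ)
    exact le_of_eq (by congr!)
  refine ⟨hle, fun h6 => le_antisymm hle (le_iInf₂ fun k hk => ?_)⟩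
  have hne : Nonempty V := by
    by_contra hV
    rw [not_nonempty_iff] at hV
    simp [SimpleGraph.maxDegree] at h6
  obtain ⟨v, hv⟩ := G.exists_maximal_degree_vertex
  have h1 := SimpleGraph.degree_lt_of_isChoosable_square hk v
  have h2 : 7 ≤ k := by
    refine Nat.lt_of_le_of_lt (le_of_eq ?_) h1
    rw [← h6, hv]
    congr!
  exact_mod_cast h2
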